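/- Let $r\ge 1$ be an integer. For each $n\ge 1$ let $X_{n,1},\dots,X_{n,n}$ be independent, identically distributed random variables with values in a (finite or infinite) set $M_n\subset\{0,1,2,\dots\}$ of urns, defined on a probability space that may depend on $n$; $X_{n,k}$ is the urn selected by the $k$-th of $n$ balls. Put $p_{n,m}=\mathbb P(X_{n,1}=m)$ for $m\in M_n$ and $p_n^*=\sup_{m\in M_n}p_{n,m}$. Let $$V_{n,r}=\#\Bigl\{k\in\{1,\dots,n\}:\ \#\{j<k: X_{n,j}=X_{n,k}\}\ge r\Bigr\}$$ be the overflow for urns of capacity $r$, that is, the number of the $n$ balls that select an urn already selected by at least $r$ earlier balls. Let $\mu>0$, and suppose that, as $n\to\infty$, $$n^{r+1}\sum_{m\in M_n}p_{n,m}^{\,r+1}\to (r+1)!\,\mu\qquad\text{and}\qquad n\,p_n^*\to 0.$$ Then $V_{n,r}$ converges in distribution, as $n\to\infty$, to the Poisson distribution $\mathrm{Pois}(\mu)$ with parameter $\mu$. -/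

import Mathlib

open MeasureTheory ProbabilityTheory Filter Topology
open scoped NNReal Nat

/-- The number of balls thrown strictly before ball `k` that selected urn `m`, where `x j` is
the urn selected by ball `j`. -/
def ballsBefore {n : ℕ} (x : Fin n → ℕ) (k : Fin n) (m : ℕ) : ℕ :=
  ∑ j : Fin n, if j < k ∧ x j = m then 1 else 0

/-- The indicator that ball `k` lands in the overflow: the urn it selects was selected by at
least `r` of the earlier balls, so that it already holds `r` balls and is full. -/
def overflowIndicator {n : ℕ} (r : ℕ) (x : Fin n → ℕ) (k : Fin n) : ℕ :=
  if r ≤ ballsBefore x k (x k) then 1 else 0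

/-- The size of the overflow when the `n` balls select the urns `x 0, …, x (n - 1)` in this
order and every urn has capacity `r`. -/
def overflow {n : ℕ} (r : ℕ) (x : Fin n → ℕ) : ℕ :=
  ∑ k : Fin n, overflowIndicator r x k

/-!
Call a set of balls monochromatic if all its balls select the same urn, and let `W` be the number of
monochromatic sets of `r + 1` balls. A ball preceded by `b` balls in its urn is the latest ball of
exactly `b.choose r` such sets, which is its contribution `1` or `0` to the overflow unless `b > r`.
Hence the overflow equals `W` unless some `r + 2` balls share an urn (`overflow_eq_card_isMono`),
an event of probability at most `n ^ (r + 2) * ∑ p ^ (r + 2)`, which is at most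
`(n p*) * n ^ (r + 1) * ∑ p ^ (r + 1)` and so vanishes in the limit.

The mean `lam` of `W` is `n.choose (r + 1) * ∑ p ^ (r + 1)`, which tends to `μ`. To see that `W` is
asymptotically Poisson, note that `(k + 1) P(W = k + 1)` is the sum over all sets `S` of `r + 1`
balls of the probability that `S` is monochromatic and `W = k + 1`. The sets disjoint from `S` are
independent of `S`, and the sets meeting `S` rarely matter, so this sum is close to `lam P(W = k)`.
The error is that of the local Chen–Stein method (`abs_poisson_recursion_le`): it runs over the
pairs of intersecting sets, and a pair with a union of `a` balls can be chosen in at most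
`4 ^ a * n ^ a` ways, with `a ≤ 2 r + 1`, so the power sums control it
(`abs_poisson_recursion_monoEvent_le`).

The limiting recursion `(k + 1) q (k + 1) = μ q k` determines the Poisson mass function up to a
factor, and the factor is fixed by tightness, which is Markov's inequality for `W`
(`tendsto_poisson_of_recursion`). No Stein equation has to be solved, since only the limit of
each probability `P(W = k)` is needed. On `ℕ` these limits amount to convergence in distribution.
-/

/-! ### Counting events and the local Chen–Stein estimate -/

/-- Two sets that agree outside `U` have probabilities differing by at most that of `U`. -/
theorem abs_measureReal_sub_le {Ω : Type*} [MeasurableSpace Ω] {P : Measure Ω}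
    [IsFiniteMeasure P] {S T U : Set Ω} (hST : S ⊆ T ∪ U) (hTS : T ⊆ S ∪ U) :
    |P.real S - P.real T| ≤ P.real U := by
  have h1 := (measureReal_mono (μ := P) hST).trans (measureReal_union_le T U)
  have h2 := (measureReal_mono (μ := P) hTS).trans (measureReal_union_le S U)
  rw [abs_le]
  constructor <;> linarith

/-- The number of the events `A i`, `i ∈ s`, that occur at the outcome `ω`. -/
noncomputable def eventCount {Ω ι : Type*} (s : Finset ι) (A : ι → Set Ω) (ω : Ω) : ℕ :=
  ∑ i ∈ s, (A i).indicator (fun _ => 1) ω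

theorem measurable_eventCount {Ω ι : Type*} [MeasurableSpace Ω] {A : ι → Set Ω}
    (hA : ∀ i, MeasurableSet (A i)) (s : Finset ι) : Measurable (eventCount s A) :=
  Finset.measurable_sum s fun i _ => measurable_const.indicator (hA i)

theorem eventCount_cast {Ω ι : Type*} (s : Finset ι) (A : ι → Set Ω) (ω : Ω) :
    (eventCount s A ω : ℝ) = ∑ i ∈ s, (A i).indicator (fun _ => (1 : ℝ)) ω := by
  classical simp [eventCount, Set.indicator_apply]

theorem setIntegral_eventCount {Ω ι : Type*} [MeasurableSpace Ω] (P : Measure Ω)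
    [IsFiniteMeasure P] {A : ι → Set Ω} (hA : ∀ i, MeasurableSet (A i)) (s : Finset ι)
    (B : Set Ω) :
    ∫ ω in B, (eventCount s A ω : ℝ) ∂P = ∑ i ∈ s, P.real (A i ∩ B) := by
  simp_rw [eventCount_cast]
  rw [integral_finsetSum]
  · refine Finset.sum_congr rfl fun i _ => ?_
    rw [integral_indicator_const _ (hA i)]
    simp [measureReal_restrict_apply (hA i)]
  · exact fun i _ => (integrable_const _).indicator (hA i)

theorem integrable_eventCount {Ω ι : Type*} [MeasurableSpace Ω] (P : Measure Ω)
    [IsFiniteMeasure P] {A : ι → Set Ω} (hA : ∀ i, MeasurableSet (A i)) (s : Finset ι) :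
    Integrable (fun ω => (eventCount s A ω : ℝ)) P := by
  simp_rw [eventCount_cast]
  exact integrable_finsetSum _ fun i _ => (integrable_const _).indicator (hA i)

theorem mul_measureReal_eventCount_eq {Ω ι : Type*} [MeasurableSpace Ω] (P : Measure Ω)
    [IsFiniteMeasure P] {A : ι → Set Ω} (hA : ∀ i, MeasurableSet (A i)) (s : Finset ι) (k : ℕ) :
    (k : ℝ) * P.real {ω | eventCount s A ω = k} =
      ∑ i ∈ s, P.real (A i ∩ {ω | eventCount s A ω = k}) := by
  have hB : MeasurableSet {ω | eventCount s A ω = k} :=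
    measurable_eventCount hA s (measurableSet_singleton k)
  rw [← setIntegral_eventCount P hA,
    setIntegral_congr_fun (g := fun _ => (k : ℝ)) hB (fun ω hω => by
      simp only [Set.mem_ofPred_eq] at hω
      simp [hω])]
  simp [mul_comm]

/-- Markov's inequality for the number of events that occur. -/
theorem mul_measureReal_le_eventCount_le {Ω ι : Type*} [MeasurableSpace Ω] (P : Measure Ω)
    [IsFiniteMeasure P] {A : ι → Set Ω} (hA : ∀ i, MeasurableSet (A i)) (s : Finset ι) (K : ℕ) :
    (K : ℝ) * P.real {ω | K ≤ eventCount s A ω} ≤ ∑ i ∈ s, P.real (A i) := by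
  have h := mul_meas_ge_le_integral_of_nonneg (μ := P) (f := fun ω => (eventCount s A ω : ℝ))
    (ae_of_all _ fun ω => Nat.cast_nonneg _) (integrable_eventCount P hA s) K
  have h2 := setIntegral_eventCount P hA s Set.univ
  simp only [Measure.restrict_univ, Set.inter_univ] at h2
  rw [h2] at h
  simpa using h

theorem mul_abs_one_sub_sum_eventCount_le {Ω ι : Type*} [MeasurableSpace Ω] (P : Measure Ω)
    [IsProbabilityMeasure P] {A : ι → Set Ω} (hA : ∀ i, MeasurableSet (A i)) (s : Finset ι)
    (K : ℕ) :
    (K : ℝ) * |1 - ∑ k ∈ Finset.range K, P.real {ω | eventCount s A ω = k}| ≤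
      ∑ i ∈ s, P.real (A i) := by
  have hB : ∀ B : Set ℕ, MeasurableSet (eventCount s A ⁻¹' B) :=
    fun B => measurable_eventCount hA s .of_discrete
  have hB1 : ∀ k : ℕ, MeasurableSet {ω | eventCount s A ω = k} := fun k => hB {k}
  have hBK : MeasurableSet {ω | K ≤ eventCount s A ω} := hB {k | K ≤ k}
  have hunion : ∑ k ∈ Finset.range K, P.real {ω | eventCount s A ω = k} =
      P.real {ω | K ≤ eventCount s A ω}ᶜ := by
    rw [← measureReal_biUnion_finset
      (fun i _ j _ hij => Set.disjoint_left.2 fun ω h h' => hij (h.symm.trans h'))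
      (fun k _ => hB1 k)]
    congr 1
    ext ω
    simp
  rw [hunion, probReal_compl_eq_one_sub hBK, sub_sub_cancel,
    abs_of_nonneg measureReal_nonneg]
  exact mul_measureReal_le_eventCount_le P hA s K

/-- The local Chen–Stein estimate. The event `A i` is assumed independent of the number of events
that occur outside its neighbourhood `N i`; the probability mass function of the number of events
then almost satisfies the recursion `(k + 1) q (k + 1) = lam q k` that characterizes the Poisson
distribution of mean `lam = ∑ i, P (A i)`. -/
theorem abs_poisson_recursion_le {Ω ι : Type*} [DecidableEq ι] [MeasurableSpace Ω] (P : Measure Ω)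
    [IsProbabilityMeasure P] {A : ι → Set Ω} (hA : ∀ i, MeasurableSet (A i)) (s : Finset ι)
    (N : ι → Finset ι) (hNs : ∀ i ∈ s, N i ⊆ s) (hiN : ∀ i ∈ s, i ∈ N i)
    (hind : ∀ i ∈ s, ∀ k, P.real (A i ∩ {ω | eventCount (s \ N i) A ω = k}) =
      P.real (A i) * P.real {ω | eventCount (s \ N i) A ω = k}) (k : ℕ) :
    |((k : ℝ) + 1) * P.real {ω | eventCount s A ω = k + 1}
        - (∑ i ∈ s, P.real (A i)) * P.real {ω | eventCount s A ω = k}| ≤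
      ∑ i ∈ s, ∑ j ∈ N i, P.real (A i) * P.real (A j) +
        ∑ i ∈ s, ∑ j ∈ (N i).erase i, P.real (A i ∩ A j) := by
  have h0 := mul_measureReal_eventCount_eq P hA s (k + 1)
  push_cast at h0
  rw [h0, Finset.sum_mul, ← Finset.sum_sub_distrib, ← Finset.sum_add_distrib]
  refine (Finset.abs_sum_le_sum_abs _ _).trans (Finset.sum_le_sum fun i hi => ?_)
  have hsplit : ∀ ω, eventCount s A ω = eventCount (s \ N i) A ω + eventCount (N i) A ω :=
    fun ω => (Finset.sum_sdiff (hNs i hi)).symm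
  have hsplit' : ∀ ω, eventCount (N i) A ω =
      (A i).indicator (fun _ => 1) ω + eventCount ((N i).erase i) A ω :=
    fun ω => (Finset.add_sum_erase _ _ (hiN i hi)).symm
  have hzero : ∀ (t : Finset ι) ω, ω ∉ (⋃ j ∈ t, A j) → eventCount t A ω = 0 := by
    intro t ω hω
    simp only [Set.mem_iUnion, not_exists] at hω
    exact Finset.sum_eq_zero fun j hj => by simp [hω j hj]
  -- On `A i`, the count exceeds the count outside `N i` by exactly one, unless another event of
  -- the neighbourhood occurs.
  have h1 : |P.real (A i ∩ {ω | eventCount s A ω = k + 1}) -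
      P.real (A i ∩ {ω | eventCount (s \ N i) A ω = k})| ≤
      ∑ j ∈ (N i).erase i, P.real (A i ∩ A j) := by
    have hkey : ∀ ω ∈ A i, ω ∉ (⋃ j ∈ (N i).erase i, A i ∩ A j) →
        eventCount s A ω = eventCount (s \ N i) A ω + 1 := by
      intro ω hω hω'
      rw [hsplit, hsplit', hzero ((N i).erase i) ω, Set.indicator_of_mem hω]
      intro h
      apply hω'
      simp only [Set.mem_iUnion, Set.mem_inter_iff] at h ⊢
      obtain ⟨j, hj, hjω⟩ := h
      exact ⟨j, hj, hω, hjω⟩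
    refine (abs_measureReal_sub_le (U := ⋃ j ∈ (N i).erase i, A i ∩ A j) ?_ ?_).trans
      (measureReal_biUnion_finset_le _ _)
    · rintro ω ⟨h, h'⟩
      by_cases hU : ω ∈ ⋃ j ∈ (N i).erase i, A i ∩ A j
      · exact Or.inr hU
      · have := hkey ω h hU
        simp only [Set.mem_ofPred_eq] at h'
        exact Or.inl ⟨h, by simp only [Set.mem_ofPred_eq]; omega⟩
    · rintro ω ⟨h, h'⟩
      by_cases hU : ω ∈ ⋃ j ∈ (N i).erase i, A i ∩ A j
      · exact Or.inr hU
      · have := hkey ω h hU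
        simp only [Set.mem_ofPred_eq] at h'
        exact Or.inl ⟨h, by simp only [Set.mem_ofPred_eq]; omega⟩
  have h2 : |P.real {ω | eventCount (s \ N i) A ω = k} - P.real {ω | eventCount s A ω = k}| ≤
      ∑ j ∈ N i, P.real (A j) := by
    refine (abs_measureReal_sub_le (U := ⋃ j ∈ N i, A j) ?_ ?_).trans
      (measureReal_biUnion_finset_le _ _)
    all_goals
      intro ω h
      by_cases hU : ω ∈ ⋃ j ∈ N i, A j
      · exact Or.inr hU
      · have := hsplit ω
        rw [hzero _ ω hU] at this
        simp only [Set.mem_ofPred_eq] at h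
        exact Or.inl (by simp only [Set.mem_ofPred_eq]; omega)
  rw [hind i hi k] at h1
  have h3 : |P.real (A i) * P.real {ω | eventCount (s \ N i) A ω = k} -
      P.real (A i) * P.real {ω | eventCount s A ω = k}| ≤
      ∑ j ∈ N i, P.real (A i) * P.real (A j) := by
    rw [← mul_sub, abs_mul, abs_of_nonneg measureReal_nonneg, ← Finset.mul_sum]
    exact mul_le_mul_of_nonneg_left h2 measureReal_nonneg
  have := abs_sub_le (P.real (A i ∩ {ω | eventCount s A ω = k + 1}))
    (P.real (A i) * P.real {ω | eventCount (s \ N i) A ω = k})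
    (P.real (A i) * P.real {ω | eventCount s A ω = k})
  linarith

/-! ### Convergence to the Poisson distribution -/

/-- A tight sequence of probability mass functions that asymptotically satisfies the recursion
`(k + 1) q (k + 1) = μ q k` converges to the Poisson mass function. -/
theorem tendsto_poisson_of_recursion {q : ℕ → ℕ → ℝ} {lam : ℕ → ℝ} {μ : ℝ}
    (hq0 : ∀ n k, 0 ≤ q n k) (hq1 : ∀ n k, q n k ≤ 1)
    (htight : ∀ n (K : ℕ), (K : ℝ) * |1 - ∑ k ∈ Finset.range K, q n k| ≤ lam n)
    (hlam : Tendsto lam atTop (𝓝 μ))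
    (hrec : ∀ k : ℕ, Tendsto (fun n => ((k : ℝ) + 1) * q n (k + 1) - lam n * q n k) atTop (𝓝 0))
    (k : ℕ) : Tendsto (fun n => q n k) atTop (𝓝 (Real.exp (-μ) * μ ^ k / k !)) := by
  have hbdd : ∀ k, Tendsto (fun n => (lam n - μ) * q n k) atTop (𝓝 0) := by
    intro k
    have h := (tendsto_sub_nhds_zero_iff.2 hlam).abs
    rw [abs_zero] at h
    refine squeeze_zero_norm (fun n => ?_) h
    rw [Real.norm_eq_abs, abs_mul, abs_of_nonneg (hq0 n k)]
    exact mul_le_of_le_one_right (abs_nonneg _) (hq1 n k)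
  -- All masses are asymptotically the Poisson multiples of the mass at `0`.
  have hratio : ∀ k : ℕ, Tendsto (fun n => q n k - μ ^ k / k ! * q n 0) atTop (𝓝 0) := by
    intro k
    induction k with
    | zero => simp
    | succ k ih =>
      have h := (((hrec k).add (hbdd k)).add (ih.const_mul μ)).div_const ((k : ℝ) + 1)
      simp only [add_zero, mul_zero, zero_div] at h
      refine h.congr fun n => ?_
      have hk : (k : ℝ) + 1 ≠ 0 := by positivity
      rw [Nat.factorial_succ]
      push_cast
      field_simp
      ring
  have hpartial : ∀ K : ℕ, Tendsto (fun n => ∑ k ∈ Finset.range K, q n k -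
      (∑ k ∈ Finset.range K, μ ^ k / k !) * q n 0) atTop (𝓝 0) := by
    intro K
    have h := tendsto_finsetSum (Finset.range K) fun k _ => hratio k
    simp only [Finset.sum_const_zero] at h
    refine h.congr fun n => ?_
    rw [Finset.sum_sub_distrib, Finset.sum_mul]
  have hexp : Tendsto (fun K => ∑ k ∈ Finset.range K, μ ^ k / (k ! : ℝ)) atTop
      (𝓝 (Real.exp μ)) := by
    have h := (NormedSpace.expSeries_div_hasSum_exp μ).tendsto_sum_nat
    rwa [← Real.exp_eq_exp_ℝ] at h
  have hone : Tendsto (fun n => Real.exp μ * q n 0 - 1) atTop (𝓝 0) := by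
    rw [Metric.tendsto_atTop]
    intro ε hε
    have hK1 : ∀ᶠ K : ℕ in atTop, |∑ k ∈ Finset.range K, μ ^ k / (k ! : ℝ) - Real.exp μ| < ε / 3 :=
      (Metric.tendsto_nhds.1 hexp) (ε / 3) (by positivity)
    have hK2 : ∀ᶠ K : ℕ in atTop, (μ + 1) / (K : ℝ) < ε / 3 :=
      (tendsto_const_div_atTop_nhds_zero_nat (μ + 1)).eventually (gt_mem_nhds (by positivity))
    obtain ⟨K, hKe, hKt, hKpos⟩ := (hK1.and (hK2.and (eventually_gt_atTop 0))).exists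
    have hn1 : ∀ᶠ n in atTop, |∑ k ∈ Finset.range K, q n k -
        (∑ k ∈ Finset.range K, μ ^ k / k !) * q n 0 - 0| < ε / 3 :=
      (Metric.tendsto_nhds.1 (hpartial K)) (ε / 3) (by positivity)
    have hn2 : ∀ᶠ n in atTop, lam n < μ + 1 := hlam.eventually (gt_mem_nhds (by linarith))
    rw [← eventually_atTop]
    filter_upwards [hn1, hn2] with n h1 h2
    have hK : (0 : ℝ) < K := by exact_mod_cast hKpos
    have h3 : |1 - ∑ k ∈ Finset.range K, q n k| < ε / 3 := by
      refine lt_of_le_of_lt ?_ hKt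
      rw [le_div_iff₀ hK, mul_comm]
      exact (htight n K).trans h2.le
    have h4 : |(∑ k ∈ Finset.range K, μ ^ k / (k ! : ℝ) - Real.exp μ) * q n 0| < ε / 3 := by
      rw [abs_mul, abs_of_nonneg (hq0 n 0)]
      exact (mul_le_of_le_one_right (abs_nonneg _) (hq1 n 0)).trans_lt hKe
    rw [Real.dist_eq, sub_zero]
    rw [abs_lt] at *
    constructor <;> linarith
  have hzero : Tendsto (fun n => q n 0) atTop (𝓝 (Real.exp (-μ))) := by
    have h := (hone.add_const 1).const_mul (Real.exp (-μ))
    simp only [zero_add, mul_one] at h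
    refine h.congr fun n => ?_
    rw [sub_add_cancel, ← mul_assoc, ← Real.exp_add]
    simp
  have h := (hratio k).add (hzero.const_mul (μ ^ k / k !))
  simp only [zero_add] at h
  rw [show Real.exp (-μ) * μ ^ k / k ! = μ ^ k / k ! * Real.exp (-μ) by ring]
  exact h.congr fun n => by ring

/-- Convergence in distribution of random variables with values in `ℕ` follows from the pointwise
convergence of their mass functions. -/
theorem tendstoInDistribution_nat_of_tendsto_singleton {Ω : ℕ → Type*}
    [∀ n, MeasurableSpace (Ω n)] (P : ∀ n, Measure (Ω n)) [∀ n, IsProbabilityMeasure (P n)]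
    {V : ∀ n, Ω n → ℕ} (hV : ∀ n, Measurable (V n)) (ν : Measure ℕ) [IsProbabilityMeasure ν]
    (h : ∀ k, Tendsto (fun n => (P n).real {ω | V n ω = k}) atTop (𝓝 (ν.real {k}))) :
    TendstoInDistribution V atTop (id : ℕ → ℕ) P ν := by
  refine ⟨fun n => (hV n).aemeasurable, aemeasurable_id, ?_⟩
  have hsub : IsPiSystem {s : Set ℕ | s.Subsingleton} :=
    fun s hs t _ _ => hs.anti Set.inter_subset_left
  refine hsub.tendsto_probabilityMeasure_of_tendsto_of_mem (fun s _ => .of_discrete) ?_ ?_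
  · intro u _ x hx
    exact ⟨{x}, Set.subsingleton_singleton, by simp [nhds_discrete], by simpa using hx⟩
  · intro s hs
    rcases hs.eq_empty_or_singleton with rfl | ⟨k, rfl⟩
    · simp
    · rw [← NNReal.tendsto_coe]
      have hl : ∀ n, (((P n).map (V n)) {k}).toReal = (P n).real {ω | V n ω = k} := fun n => by
        rw [Measure.map_apply (hV n) (measurableSet_singleton k)]
        rfl
      simp only [Measure.map_id]
      exact (h k).congr fun n => (hl n).symm

/-! ### Monochromatic sets of balls and the overflow -/

/-- All the balls of `S` select the same urn, where `x i` is the urn selected by ball `i`. -/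
def IsMono {V : Type*} (x : V → ℕ) (S : Finset V) : Prop := ∃ m, ∀ i ∈ S, x i = m

theorem IsMono.mono {V : Type*} {x : V → ℕ} {S T : Finset V} (h : IsMono x T) (hST : S ⊆ T) :
    IsMono x S :=
  h.imp fun _ hm i hi => hm i (hST hi)

theorem isMono_congr {V : Type*} {x y : V → ℕ} {S : Finset V} (h : ∀ i ∈ S, x i = y i) :
    IsMono x S ↔ IsMono y S :=
  exists_congr fun _ => forall₂_congr fun i hi => by rw [h i hi]

theorem isMono_union_iff {V : Type*} [DecidableEq V] {x : V → ℕ} {S T : Finset V}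
    (hST : ¬ Disjoint S T) : IsMono x (S ∪ T) ↔ IsMono x S ∧ IsMono x T := by
  refine ⟨fun h => ⟨h.mono Finset.subset_union_left, h.mono Finset.subset_union_right⟩, ?_⟩
  rintro ⟨⟨a, ha⟩, ⟨b, hb⟩⟩
  obtain ⟨i, hiS, hiT⟩ := Finset.not_disjoint_iff.1 hST
  have hab : b = a := (hb i hiT).symm.trans (ha i hiS)
  exact ⟨a, fun j hj => (Finset.mem_union.1 hj).elim (ha j) fun h => (hb j h).trans hab⟩

theorem ballsBefore_eq_card {n : ℕ} (x : Fin n → ℕ) (k : Fin n) (m : ℕ) :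
    ballsBefore x k m = (Finset.univ.filter fun j => j < k ∧ x j = m).card := by
  rw [ballsBefore, Finset.card_filter]

/-- A monochromatic set of `r + 1` balls is determined by its latest ball `k` together with `r` of
the earlier balls that share the urn of `k`. -/
theorem card_isMono_eq_sum_choose {n : ℕ} (r : ℕ) (x : Fin n → ℕ) [DecidablePred (IsMono x)] :
    (((Finset.univ : Finset (Fin n)).powersetCard (r + 1)).filter (IsMono x)).card =
      ∑ k : Fin n, (ballsBefore x k (x k)).choose r := by
  classical
  simp_rw [ballsBefore_eq_card, ← Finset.card_powersetCard]
  rw [← Finset.card_sigma]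
  symm
  refine Finset.card_bij (fun y _ => insert y.1 y.2) ?_ ?_ ?_
  · rintro ⟨k, T⟩ h
    simp only [Finset.mem_sigma, Finset.mem_univ, true_and, Finset.mem_powersetCard] at h
    have hT : ∀ j ∈ T, j < k ∧ x j = x k := fun j hj => by simpa using h.1 hj
    simp only [Finset.mem_filter, Finset.mem_powersetCard, Finset.subset_univ, true_and]
    refine ⟨?_, x k, ?_⟩
    · rw [Finset.card_insert_of_notMem fun hk => (hT k hk).1.false, h.2]
    · intro i hi
      rcases Finset.mem_insert.1 hi with rfl | hi
      · rfl
      · exact (hT i hi).2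
  · rintro ⟨k, T⟩ h ⟨k', T'⟩ h' heq
    simp only [Finset.mem_sigma, Finset.mem_univ, true_and, Finset.mem_powersetCard] at h h' heq
    have hT : ∀ j ∈ T, j < k := fun j hj => by
      have := h.1 hj
      simp at this
      exact this.1
    have hT' : ∀ j ∈ T', j < k' := fun j hj => by
      have := h'.1 hj
      simp at this
      exact this.1
    have hkk : k = k' := by
      apply le_antisymm
      · have : k ∈ insert k' T' := heq ▸ Finset.mem_insert_self k T
        rcases Finset.mem_insert.1 this with h | h
        · exact h.le
        · exact (hT' k h).le
      · have : k' ∈ insert k T := heq ▸ Finset.mem_insert_self k' T'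
        rcases Finset.mem_insert.1 this with h | h
        · exact h.le
        · exact (hT k' h).le
    subst hkk
    have hTT : T = T' := by
      rw [← Finset.erase_insert fun hk => (hT k hk).false, heq,
        Finset.erase_insert fun hk => (hT' k hk).false]
    rw [hTT]
  · intro S hS
    simp only [Finset.mem_filter, Finset.mem_powersetCard, Finset.subset_univ, true_and] at hS
    obtain ⟨hcard, m, hm⟩ := hS
    have hne : S.Nonempty := Finset.card_pos.1 (by omega)
    have hmem := S.max'_mem hne
    refine ⟨⟨S.max' hne, S.erase (S.max' hne)⟩, ?_, Finset.insert_erase hmem⟩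
    simp only [Finset.mem_sigma, Finset.mem_univ, true_and, Finset.mem_powersetCard]
    refine ⟨fun j hj => ?_, by rw [Finset.card_erase_of_mem hmem, hcard]; rfl⟩
    have hj' := Finset.mem_erase.1 hj
    simp only [Finset.mem_filter, Finset.mem_univ, true_and]
    exact ⟨lt_of_le_of_ne (S.le_max' j hj'.2) hj'.1, (hm j hj'.2).trans (hm _ hmem).symm⟩

/-- As long as no urn is selected by `r + 2` balls, the overflow is the number of monochromatic
sets of `r + 1` balls. -/
theorem overflow_eq_card_isMono {n : ℕ} (r : ℕ) (x : Fin n → ℕ) [DecidablePred (IsMono x)]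
    (hx : ∀ S ∈ (Finset.univ : Finset (Fin n)).powersetCard (r + 2), ¬ IsMono x S) :
    overflow r x =
      (((Finset.univ : Finset (Fin n)).powersetCard (r + 1)).filter (IsMono x)).card := by
  classical
  rw [card_isMono_eq_sum_choose, overflow]
  refine Finset.sum_congr rfl fun k _ => ?_
  have hle : ballsBefore x k (x k) ≤ r := by
    by_contra! hlt
    have hcard : 0 < ∑ k : Fin n, (ballsBefore x k (x k)).choose (r + 1) :=
      Finset.sum_pos' (fun _ _ => Nat.zero_le _) ⟨k, Finset.mem_univ k, Nat.choose_pos hlt⟩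
    rw [← card_isMono_eq_sum_choose, Finset.card_pos] at hcard
    obtain ⟨S, hS⟩ := hcard
    rw [Finset.mem_filter] at hS
    exact hx S hS.1 hS.2
  rw [overflowIndicator]
  split_ifs with h
  · rw [le_antisymm hle h, Nat.choose_self]
  · rw [Nat.choose_eq_zero_of_lt (not_le.1 h)]

/-- Grouping pairs of finite sets by the size `a` of their union: at most `4 ^ a` pairs have a
given union, and there are at most `(card V) ^ a` unions of size `a`. -/
theorem sum_card_union_le {V : Type*} [Fintype V] [DecidableEq V]
    (F : Finset (Finset V × Finset V)) (B : Finset ℕ) (hF : ∀ y ∈ F, (y.1 ∪ y.2).card ∈ B)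
    {f : ℕ → ℝ} (hf : ∀ a, 0 ≤ f a) :
    ∑ y ∈ F, f (y.1 ∪ y.2).card ≤ ∑ a ∈ B, 4 ^ a * ((Fintype.card V : ℝ) ^ a * f a) := by
  rw [← Finset.sum_fiberwise_of_maps_to hF]
  refine Finset.sum_le_sum fun a _ => ?_
  have hcongr : ∑ y ∈ F with (y.1 ∪ y.2).card = a, f (y.1 ∪ y.2).card =
      ∑ y ∈ F with (y.1 ∪ y.2).card = a, f a :=
    Finset.sum_congr rfl fun y hy => by rw [(Finset.mem_filter.1 hy).2]
  rw [hcongr, Finset.sum_const, nsmul_eq_mul, ← mul_assoc]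
  refine mul_le_mul_of_nonneg_right ?_ (hf a)
  have hcard : (F.filter fun y => (y.1 ∪ y.2).card = a).card ≤
      4 ^ a * ((Finset.univ : Finset V).powersetCard a).card := by
    refine Finset.card_le_mul_card_image_of_maps_to (f := fun y => y.1 ∪ y.2) ?_ _ ?_
    · intro y hy
      simpa using (Finset.mem_filter.1 hy).2
    · intro U hU
      have hUa : U.card = a := (Finset.mem_powersetCard.1 hU).2
      have hsub : ((F.filter fun y => (y.1 ∪ y.2).card = a).filter fun y => y.1 ∪ y.2 = U) ⊆
          U.powerset ×ˢ U.powerset := by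
        intro y hy
        have hyU := (Finset.mem_filter.1 hy).2
        simp only [Finset.mem_product, Finset.mem_powerset]
        exact ⟨hyU ▸ Finset.subset_union_left, hyU ▸ Finset.subset_union_right⟩
      refine (Finset.card_le_card hsub).trans ?_
      rw [Finset.card_product, Finset.card_powerset, hUa, ← mul_pow]
      norm_num
  rw [Finset.card_powersetCard, Finset.card_univ] at hcard
  exact_mod_cast hcard.trans (Nat.mul_le_mul_left _ (Nat.choose_le_pow _ _))

/-! ### Probabilities of monochromatic sets -/

/-- Events that are determined by disjoint subfamilies of an independent family of random
variables are independent. -/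
theorem measureReal_inter_eq_mul_of_dependsOn {V Ω : Type*} [DecidableEq V]
    [MeasurableSpace Ω] {P : Measure Ω} {X : V → Ω → ℕ} (hmeas : ∀ i, Measurable (X i))
    (hind : iIndepFun X P) {S T : Finset V} (hST : Disjoint S T) {E F : (V → ℕ) → Prop}
    (hE : ∀ x y, (∀ i ∈ S, x i = y i) → (E x ↔ E y))
    (hF : ∀ x y, (∀ i ∈ T, x i = y i) → (F x ↔ F y)) :
    P.real ({ω | E fun i => X i ω} ∩ {ω | F fun i => X i ω}) =
      P.real {ω | E fun i => X i ω} * P.real {ω | F fun i => X i ω} := by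
  have hext : ∀ (R : Finset V) (G : (V → ℕ) → Prop),
      (∀ x y, (∀ i ∈ R, x i = y i) → (G x ↔ G y)) →
      {ω | G fun i => X i ω} = (fun ω (i : R) => X i ω) ⁻¹'
        {y | G fun i => if h : i ∈ R then y ⟨i, h⟩ else 0} := by
    intro R G hG
    ext ω
    exact hG _ _ fun i hi => by simp [hi]
  rw [hext S E hE, hext T F hF]
  simp only [measureReal_def]
  rw [(hind.indepFun_finset S T hST hmeas).measure_inter_preimage_eq_mul _ _ .of_discrete
    .of_discrete, ENNReal.toReal_mul]

/-- The event that all the balls of `S` select the same urn. -/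
def monoEvent {V Ω : Type*} (X : V → Ω → ℕ) (S : Finset V) : Set Ω :=
  {ω | IsMono (fun i => X i ω) S}

theorem measurableSet_monoEvent {V Ω : Type*} [MeasurableSpace Ω] {X : V → Ω → ℕ}
    (hmeas : ∀ i, Measurable (X i)) (S : Finset V) : MeasurableSet (monoEvent X S) := by
  have h : monoEvent X S = ⋃ m : ℕ, ⋂ i ∈ S, X i ⁻¹' {m} := by
    ext ω
    simp [monoEvent, IsMono]
  rw [h]
  exact .iUnion fun m => Finset.measurableSet_biInter S fun i _ =>
    hmeas i (measurableSet_singleton m)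

theorem eventCount_monoEvent {V Ω : Type*} (X : V → Ω → ℕ) (s : Finset (Finset V)) (ω : Ω)
    [DecidablePred (IsMono fun i => X i ω)] :
    eventCount s (monoEvent X) ω = (s.filter (IsMono fun i => X i ω)).card := by
  classical
  rw [eventCount, Finset.card_filter]
  exact Finset.sum_congr rfl fun S _ => by simp [Set.indicator_apply, monoEvent]

/-- The probability that a given nonempty set of balls is monochromatic is a power sum of the urn
probabilities. -/
theorem hasSum_measureReal_isMono {V Ω : Type*} [MeasurableSpace Ω] {P : Measure Ω}
    [IsProbabilityMeasure P] {X : V → Ω → ℕ} (hmeas : ∀ i, Measurable (X i))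
    (hind : iIndepFun X P) {M : Set ℕ} {p : ℕ → ℝ} (hmem : ∀ i ω, X i ω ∈ M)
    (hlaw : ∀ i, ∀ m ∈ M, P.real {ω | X i ω = m} = p m) {S : Finset V} (hS : S.Nonempty) :
    HasSum (fun m : M => p m ^ S.card) (P.real (monoEvent X S)) := by
  have hunion : monoEvent X S = ⋃ m : M, ⋂ i ∈ S, X i ⁻¹' {(m : ℕ)} := by
    ext ω
    simp only [monoEvent, IsMono, Set.mem_ofPred_eq, Set.mem_iUnion, Set.mem_iInter,
      Set.mem_preimage, Set.mem_singleton_iff, Subtype.exists, exists_prop]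
    constructor
    · rintro ⟨m, hm⟩
      obtain ⟨i, hi⟩ := hS
      exact ⟨m, hm i hi ▸ hmem i ω, hm⟩
    · rintro ⟨m, -, hm⟩
      exact ⟨m, hm⟩
  have hdisj : Pairwise (Function.onFun Disjoint fun m : M => ⋂ i ∈ S, X i ⁻¹' {(m : ℕ)}) := by
    intro m m' hne
    refine Set.disjoint_left.2 fun ω h h' => hne (Subtype.ext ?_)
    obtain ⟨i, hi⟩ := hS
    simp only [Set.mem_iInter, Set.mem_preimage, Set.mem_singleton_iff] at h h'
    exact (h i hi).symm.trans (h' i hi)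
  have hsum := measure_iUnion (μ := P) hdisj fun m =>
    Finset.measurableSet_biInter S fun i _ => hmeas i (measurableSet_singleton (m : ℕ))
  have hone : ∀ m : M, (P (⋂ i ∈ S, X i ⁻¹' {(m : ℕ)})).toReal = p m ^ S.card := by
    intro m
    rw [hind.measure_inter_preimage_eq_mul S (fun i _ => measurableSet_singleton (m : ℕ)),
      ENNReal.toReal_prod, ← Finset.prod_const]
    exact Finset.prod_congr rfl fun i _ => hlaw i m m.2
  rw [hunion, measureReal_def, hsum, ENNReal.tsum_toReal_eq fun m => measure_ne_top _ _]
  have := ENNReal.hasSum_toReal (hsum ▸ measure_ne_top P _)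
  simpa only [hone] using this

theorem measureReal_monoEvent {V Ω : Type*} [MeasurableSpace Ω] {P : Measure Ω}
    [IsProbabilityMeasure P] {X : V → Ω → ℕ} (hmeas : ∀ i, Measurable (X i))
    (hind : iIndepFun X P) {M : Set ℕ} {p : ℕ → ℝ} (hmem : ∀ i ω, X i ω ∈ M)
    (hlaw : ∀ i, ∀ m ∈ M, P.real {ω | X i ω = m} = p m) {S : Finset V} (hS : S.Nonempty) :
    P.real (monoEvent X S) = ∑' m : M, p m ^ S.card :=
  (hasSum_measureReal_isMono hmeas hind hmem hlaw hS).tsum_eq.symm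

theorem sum_measureReal_monoEvent {V Ω : Type*} [Fintype V] [MeasurableSpace Ω] {P : Measure Ω}
    [IsProbabilityMeasure P] {X : V → Ω → ℕ} (hmeas : ∀ i, Measurable (X i))
    (hind : iIndepFun X P) {M : Set ℕ} {p : ℕ → ℝ} (hmem : ∀ i ω, X i ω ∈ M)
    (hlaw : ∀ i, ∀ m ∈ M, P.real {ω | X i ω = m} = p m) (a : ℕ) :
    ∑ S ∈ (Finset.univ : Finset V).powersetCard (a + 1), P.real (monoEvent X S) =
      (Fintype.card V).choose (a + 1) * ∑' m : M, p m ^ (a + 1) := by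
  have h : ∀ S ∈ (Finset.univ : Finset V).powersetCard (a + 1), P.real (monoEvent X S) =
      ∑' m : M, p m ^ (a + 1) := fun S hS => by
    have hc := (Finset.mem_powersetCard.1 hS).2
    rw [measureReal_monoEvent hmeas hind hmem hlaw (Finset.card_pos.1 (by omega)), hc]
  rw [Finset.sum_congr rfl h, Finset.sum_const, Finset.card_powersetCard, Finset.card_univ,
    nsmul_eq_mul]

/-- Higher power sums of the urn probabilities are smaller by powers of the largest one. -/
theorem pow_mul_tsum_pow_le {M : Set ℕ} {p : ℕ → ℝ} (hp0 : ∀ m ∈ M, 0 ≤ p m)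
    (hp1 : ∀ m ∈ M, p m ≤ 1) {a b : ℕ} (hsum : Summable fun m : M => p m ^ a) (n : ℕ) :
    (n : ℝ) ^ (a + b) * ∑' m : M, p m ^ (a + b) ≤
      (n * ⨆ m : M, p m) ^ b * (n ^ a * ∑' m : M, p m ^ a) := by
  have hbdd : BddAbove (Set.range fun m : M => p m) :=
    ⟨1, by rintro _ ⟨m, rfl⟩; exact hp1 m m.2⟩
  have hle : ∀ m : M, p m ^ (a + b) ≤ (⨆ m : M, p m) ^ b * p m ^ a := fun m => by
    rw [pow_add, mul_comm]
    exact mul_le_mul_of_nonneg_right (pow_le_pow_left₀ (hp0 m m.2) (le_ciSup hbdd m) b)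
      (pow_nonneg (hp0 m m.2) a)
  have hs := hsum.mul_left ((⨆ m : M, p m) ^ b)
  have hs' : Summable fun m : M => p m ^ (a + b) :=
    hs.of_nonneg_of_le (fun m => pow_nonneg (hp0 m m.2) _) hle
  have h := hs'.tsum_le_tsum hle hs
  rw [tsum_mul_left] at h
  calc _ ≤ (n : ℝ) ^ (a + b) * ((⨆ m : M, p m) ^ b * ∑' m : M, p m ^ a) :=
        mul_le_mul_of_nonneg_left h (by positivity)
    _ = _ := by ring

/-- The local Chen–Stein estimate for monochromatic sets of `r + 1` balls: the neighbourhood of a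
set of balls consists of the sets that meet it. -/
theorem abs_poisson_recursion_monoEvent_le {V Ω : Type*} [Fintype V] [DecidableEq V] [Nonempty V]
    [MeasurableSpace Ω] {P : Measure Ω}
    [IsProbabilityMeasure P] {X : V → Ω → ℕ} (hmeas : ∀ i, Measurable (X i))
    (hind : iIndepFun X P) {M : Set ℕ} {p : ℕ → ℝ} (hmem : ∀ i ω, X i ω ∈ M)
    (hlaw : ∀ i, ∀ m ∈ M, P.real {ω | X i ω = m} = p m) (r k : ℕ) :
    |((k : ℝ) + 1) * P.real {ω | eventCount
          ((Finset.univ : Finset V).powersetCard (r + 1)) (monoEvent X) ω = k + 1}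
        - (∑ S ∈ (Finset.univ : Finset V).powersetCard (r + 1), P.real (monoEvent X S)) *
          P.real {ω | eventCount
            ((Finset.univ : Finset V).powersetCard (r + 1)) (monoEvent X) ω = k}| ≤
      ∑ a ∈ Finset.Icc (r + 1) (2 * r + 1),
          4 ^ a * ((Fintype.card V : ℝ) ^ a * (∑' m : M, p m ^ (r + 1)) ^ 2) +
        ∑ a ∈ Finset.Icc (r + 2) (2 * r + 1),
          4 ^ a * ((Fintype.card V : ℝ) ^ a * ∑' m : M, p m ^ a) := by
  classical
  set s := (Finset.univ : Finset V).powersetCard (r + 1) with hs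
  have hcard : ∀ S ∈ s, S.card = r + 1 := fun S hS => (Finset.mem_powersetCard.1 hS).2
  have hprob : ∀ S : Finset V, S.Nonempty → P.real (monoEvent X S) = ∑' m : M, p m ^ S.card :=
    fun S hS => measureReal_monoEvent hmeas hind hmem hlaw hS
  have hp0 : ∀ m : M, 0 ≤ p m := fun m => by
    rw [← hlaw (Classical.arbitrary V) m m.2]
    exact measureReal_nonneg
  have hcount : ∀ (t : Finset (Finset V)) (ω : Ω), eventCount t (monoEvent X) ω =
      (t.filter (IsMono fun i => X i ω)).card := fun t ω => eventCount_monoEvent X t ω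
  refine (abs_poisson_recursion_le P (measurableSet_monoEvent hmeas) s
    (fun S => s.filter fun T => ¬ Disjoint S T) (fun S _ => Finset.filter_subset _ _)
    (fun S hS => ?_) (fun S _ j => ?_) k).trans (add_le_add ?_ ?_)
  · refine Finset.mem_filter.2 ⟨hS, ?_⟩
    rw [disjoint_self, Finset.bot_eq_empty, ← Finset.card_eq_zero, hcard S hS]
    omega
  · -- Sets outside the neighbourhood of `S` only involve balls of the complement of `S`.
    simp_rw [hcount]
    refine measureReal_inter_eq_mul_of_dependsOn hmeas hind (disjoint_compl_right (a := S))
      (E := fun x => IsMono x S)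
      (F := fun x => ((s \ s.filter fun T => ¬ Disjoint S T).filter (IsMono x)).card = j)
      (fun x y h => isMono_congr h) (fun x y h => ?_)
    have : (s \ s.filter fun T => ¬ Disjoint S T).filter (IsMono x) =
        (s \ s.filter fun T => ¬ Disjoint S T).filter (IsMono y) := by
      refine Finset.filter_congr fun T hT => isMono_congr fun i hi => h i ?_
      simp only [Finset.mem_sdiff, Finset.mem_filter, not_and, not_not] at hT
      exact Finset.mem_compl.2 (Finset.disjoint_right.1 (hT.2 hT.1) hi)
    rw [this]
  · have hF := sum_card_union_le ((s ×ˢ s).filter fun y => ¬ Disjoint y.1 y.2)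
      (Finset.Icc (r + 1) (2 * r + 1)) (f := fun _ => (∑' m : M, p m ^ (r + 1)) ^ 2) ?_
      (fun _ => sq_nonneg _)
    · refine le_trans (le_of_eq ?_) hF
      rw [Finset.sum_filter, Finset.sum_product]
      refine Finset.sum_congr rfl fun S hS => ?_
      rw [Finset.sum_filter]
      refine Finset.sum_congr rfl fun T hT => ?_
      rw [hprob S (Finset.card_pos.1 (by rw [hcard S hS]; omega)),
        hprob T (Finset.card_pos.1 (by rw [hcard T hT]; omega)), hcard S hS, hcard T hT, sq]
    · intro y hy
      simp only [Finset.mem_filter, Finset.mem_product] at hy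
      have h1 := Finset.card_union_add_card_inter y.1 y.2
      have h2 := Finset.card_pos.2 (Finset.not_disjoint_iff_nonempty_inter.1 hy.2)
      have h3 := Finset.card_le_card (Finset.subset_union_left (s₁ := y.1) (s₂ := y.2))
      rw [hcard _ hy.1.1] at h1 h3
      rw [hcard _ hy.1.2] at h1
      exact Finset.mem_Icc.2 ⟨h3, by omega⟩
  · have hF := sum_card_union_le ((s ×ˢ s).filter fun y => ¬ Disjoint y.1 y.2 ∧ y.2 ≠ y.1)
      (Finset.Icc (r + 2) (2 * r + 1)) (f := fun a => ∑' m : M, p m ^ a) ?_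
      (fun a => tsum_nonneg fun m => pow_nonneg (hp0 m) a)
    · refine le_trans (le_of_eq ?_) hF
      rw [Finset.sum_filter, Finset.sum_product]
      refine Finset.sum_congr rfl fun S hS => ?_
      rw [← Finset.filter_erase, ← Finset.filter_ne', Finset.filter_filter, Finset.sum_filter]
      refine Finset.sum_congr rfl fun T hT => ?_
      simp only [and_comm (a := T ≠ S)]
      split_ifs with h
      · have hST : monoEvent X S ∩ monoEvent X T = monoEvent X (S ∪ T) :=
          Set.ext fun ω => (isMono_union_iff h.1).symm
        have hne : S.Nonempty := Finset.card_pos.1 (by rw [hcard S hS]; omega)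
        rw [hST, hprob _ (hne.mono Finset.subset_union_left)]
      · rfl
    · intro y hy
      simp only [Finset.mem_filter, Finset.mem_product] at hy
      obtain ⟨⟨hy1, hy2⟩, hdis, hne⟩ := hy
      have h1 := Finset.card_union_add_card_inter y.1 y.2
      have h2 := Finset.card_pos.2 (Finset.not_disjoint_iff_nonempty_inter.1 hdis)
      have h3 : r + 1 < (y.1 ∪ y.2).card := by
        by_contra! hle
        have e1 := Finset.eq_of_subset_of_card_le
          (Finset.subset_union_left (s₁ := y.1) (s₂ := y.2)) (by rw [hcard _ hy1]; exact hle)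
        have e2 := Finset.eq_of_subset_of_card_le
          (Finset.subset_union_right (s₁ := y.1) (s₂ := y.2)) (by rw [hcard _ hy2]; exact hle)
        exact hne (e2.trans e1.symm)
      rw [hcard _ hy1, hcard _ hy2] at h1
      exact Finset.mem_Icc.2 ⟨h3, by omega⟩

/-- The overflow and the number of monochromatic sets of `r + 1` balls differ only if some set of
`r + 2` balls is monochromatic. -/
theorem abs_measureReal_overflow_sub_le {n : ℕ} {Ω : Type*} [MeasurableSpace Ω] {P : Measure Ω}
    [IsProbabilityMeasure P] (X : Fin n → Ω → ℕ) (r k : ℕ) :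
    |P.real {ω | overflow r (fun i => X i ω) = k} - P.real {ω | eventCount
        ((Finset.univ : Finset (Fin n)).powersetCard (r + 1)) (monoEvent X) ω = k}| ≤
      ∑ S ∈ (Finset.univ : Finset (Fin n)).powersetCard (r + 2), P.real (monoEvent X S) := by
  classical
  have hkey : ∀ ω, ω ∉ ⋃ S ∈ (Finset.univ : Finset (Fin n)).powersetCard (r + 2), monoEvent X S →
      overflow r (fun i => X i ω) = eventCount
        ((Finset.univ : Finset (Fin n)).powersetCard (r + 1)) (monoEvent X) ω := by
    intro ω hω
    simp only [Set.mem_iUnion, not_exists] at hω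
    rw [eventCount_monoEvent, overflow_eq_card_isMono r _ hω]
  refine (abs_measureReal_sub_le (U := ⋃ S ∈ (Finset.univ : Finset (Fin n)).powersetCard (r + 2),
    monoEvent X S) ?_ ?_).trans (measureReal_biUnion_finset_le _ _)
  all_goals
    intro ω h
    by_cases hU : ω ∈ ⋃ S ∈ (Finset.univ : Finset (Fin n)).powersetCard (r + 2), monoEvent X S
    · exact Or.inr hU
    · have := hkey ω hU
      simp only [Set.mem_ofPred_eq] at h
      exact Or.inl (by simp only [Set.mem_ofPred_eq]; omega)

/-! ### The Poisson limit of the overflow -/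

theorem tendsto_choose_mul_of_tendsto_pow_mul {σ : ℕ → ℝ} {a : ℕ} {c : ℝ}
    (h : Tendsto (fun n : ℕ => (n : ℝ) ^ a * σ n) atTop (𝓝 (a ! * c))) :
    Tendsto (fun n : ℕ => (n.choose a : ℝ) * σ n) atTop (𝓝 c) := by
  have h1 : Tendsto (fun n : ℕ => (n : ℝ) * (1 / n)) atTop (𝓝 1) := by
    refine tendsto_const_nhds.congr' ?_
    filter_upwards [eventually_gt_atTop 0] with n hn
    have : (n : ℝ) ≠ 0 := by positivity
    field_simp
  have h2 := (tendsto_choose_mul_pow_atTop a h1).mul h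
  have ha : (a ! : ℝ) ≠ 0 := by positivity
  rw [show (1 : ℝ) ^ a / a ! * (a ! * c) = c by field_simp; simp] at h2
  refine h2.congr' ?_
  filter_upwards [eventually_gt_atTop 0] with n hn
  have : (n : ℝ) ≠ 0 := by positivity
  calc (n.choose a : ℝ) * (1 / n) ^ a * (n ^ a * σ n) = n.choose a * (1 / n * n) ^ a * σ n := by
        rw [mul_pow]
        ring
    _ = n.choose a * σ n := by rw [one_div_mul_cancel this, one_pow, mul_one]

theorem mainTheorem1
    {Ω : ℕ → Type*} [∀ n, MeasurableSpace (Ω n)]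
    (P : ∀ n, Measure (Ω n)) [∀ n, IsProbabilityMeasure (P n)]
    (M : ℕ → Set ℕ) (p : ℕ → ℕ → ℝ)
    (X : ∀ n, Fin n → Ω n → ℕ)
    (hX_meas : ∀ n k, Measurable (X n k))
    (hX_mem : ∀ n k ω, X n k ω ∈ M n)
    (hX_indep : ∀ n, iIndepFun (X n) (P n))
    (hX_law : ∀ n k, ∀ m ∈ M n, (P n).real {ω | X n k ω = m} = p n m)
    (r : ℕ) (hr : 1 ≤ r) (μ : ℝ≥0) (hμ : 0 < μ)
    (h_intensity : Tendsto (fun n : ℕ => (n : ℝ) ^ (r + 1) * ∑' m : M n, p n m ^ (r + 1))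
      atTop (𝓝 ((r + 1)! * (μ : ℝ))))
    (h_max : Tendsto (fun n : ℕ => (n : ℝ) * ⨆ m : M n, p n m) atTop (𝓝 0)) :
    TendstoInDistribution (fun n ω => overflow r (fun k => X n k ω)) atTop
      (id : ℕ → ℕ) P (poissonMeasure μ) := by
  set σ : ℕ → ℕ → ℝ := fun n a => ∑' m : M n, p n m ^ a
  set D : ℕ → ℝ := fun n => (n : ℝ) ^ (r + 1) * σ n (r + 1) with hD
  set E : ℕ → ℝ := fun n => (n : ℝ) * ⨆ m : M n, p n m
  let s : ∀ n, Finset (Finset (Fin n)) := fun n => Finset.univ.powersetCard (r + 1)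
  set W : ∀ n, Ω n → ℕ := fun n => eventCount (s n) (monoEvent (X n))
  set lam : ℕ → ℝ := fun n => ∑ S ∈ s n, (P n).real (monoEvent (X n) S)
  have hcast : Tendsto (fun n : ℕ => (n : ℝ)⁻¹) atTop (𝓝 0) :=
    tendsto_inv_atTop_zero.comp tendsto_natCast_atTop_atTop
  have hlam : Tendsto lam atTop (𝓝 (μ : ℝ)) := by
    refine (tendsto_choose_mul_of_tendsto_pow_mul h_intensity).congr fun n => ?_
    have h := sum_measureReal_monoEvent (hX_meas n) (hX_indep n) (hX_mem n) (hX_law n) r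
    rw [Fintype.card_fin] at h
    exact h.symm
  -- Power sums of order exceeding `r + 1` are negligible.
  have hpow : ∀ n : ℕ, 0 < n → ∀ b, (n : ℝ) ^ (r + 1 + b) * σ n (r + 1 + b) ≤ E n ^ b * D n := by
    intro n hn b
    have hsum := (hasSum_measureReal_isMono (S := {(⟨0, hn⟩ : Fin n)}) (hX_meas n) (hX_indep n)
      (hX_mem n) (hX_law n) (Finset.singleton_nonempty _)).summable
    have hp0 : ∀ m ∈ M n, 0 ≤ p n m := fun m hm => by
      rw [← hX_law n ⟨0, hn⟩ m hm]
      exact measureReal_nonneg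
    have hp1 : ∀ m ∈ M n, p n m ≤ 1 := fun m hm => by
      rw [← hX_law n ⟨0, hn⟩ m hm]
      exact measureReal_le_one
    rw [Finset.card_singleton] at hsum
    simp only [pow_one] at hsum
    refine pow_mul_tsum_pow_le hp0 hp1 (hsum.of_nonneg_of_le
      (fun m => pow_nonneg (hp0 m m.2) _) fun m => ?_) n
    exact pow_le_of_le_one (hp0 m m.2) (hp1 m m.2) (Nat.succ_ne_zero r)
  have hED : ∀ b, b ≠ 0 → Tendsto (fun n => E n ^ b * D n) atTop (𝓝 0) := fun b hb => by
    have h := (h_max.pow b).mul h_intensity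
    rwa [zero_pow hb, zero_mul] at h
  have hrec : ∀ k : ℕ, Tendsto (fun n => ((k : ℝ) + 1) * (P n).real {ω | W n ω = k + 1} -
      lam n * (P n).real {ω | W n ω = k}) atTop (𝓝 0) := by
    intro k
    have hlim : Tendsto (fun n : ℕ =>
        ∑ a ∈ Finset.Icc (r + 1) (2 * r + 1), (4 : ℝ) ^ a * (D n ^ 2 * (n : ℝ)⁻¹) +
        ∑ a ∈ Finset.Icc (r + 2) (2 * r + 1), 4 ^ a * (E n ^ (a - (r + 1)) * D n))
        atTop (𝓝 0) := by
      have h1 : ∀ a ∈ Finset.Icc (r + 1) (2 * r + 1), Tendsto (fun n : ℕ =>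
          (4 : ℝ) ^ a * (D n ^ 2 * (n : ℝ)⁻¹)) atTop (𝓝 0) := fun a _ => by
        simpa using ((h_intensity.pow 2).mul hcast).const_mul ((4 : ℝ) ^ a)
      have h2 : ∀ a ∈ Finset.Icc (r + 2) (2 * r + 1), Tendsto (fun n : ℕ =>
          (4 : ℝ) ^ a * (E n ^ (a - (r + 1)) * D n)) atTop (𝓝 0) := fun a ha => by
        have := (Finset.mem_Icc.1 ha).1
        simpa using (hED (a - (r + 1)) (by omega)).const_mul ((4 : ℝ) ^ a)
      simpa using (tendsto_finsetSum _ h1).add (tendsto_finsetSum _ h2)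
    refine squeeze_zero_norm' ?_ hlim
    filter_upwards [eventually_gt_atTop 0] with n hn
    have : Nonempty (Fin n) := ⟨⟨0, hn⟩⟩
    have hn1 : (1 : ℝ) ≤ n := by exact_mod_cast hn
    have h := abs_poisson_recursion_monoEvent_le (hX_meas n) (hX_indep n) (hX_mem n) (hX_law n) r k
    rw [Fintype.card_fin] at h
    refine h.trans (add_le_add (Finset.sum_le_sum fun a ha => ?_)
      (Finset.sum_le_sum fun a ha => ?_))
    · -- Intersecting pairs cover at most `2 * r + 1` balls, one less than disjoint ones.
      refine mul_le_mul_of_nonneg_left ?_ (by positivity)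
      have hle : (n : ℝ) ^ a ≤ (n : ℝ) ^ (2 * r + 1) :=
        pow_le_pow_right₀ hn1 (Finset.mem_Icc.1 ha).2
      calc (n : ℝ) ^ a * σ n (r + 1) ^ 2 ≤ (n : ℝ) ^ (2 * r + 1) * σ n (r + 1) ^ 2 :=
            mul_le_mul_of_nonneg_right hle (sq_nonneg _)
        _ = D n ^ 2 * (n : ℝ)⁻¹ := by
            have : (n : ℝ) ≠ 0 := by positivity
            simp only [hD]
            field_simp
            ring
    · refine mul_le_mul_of_nonneg_left ?_ (by positivity)
      have h := hpow n hn (a - (r + 1))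
      have ha' := (Finset.mem_Icc.1 ha).1
      rwa [Nat.add_sub_cancel' (by omega)] at h
  have hWlim := tendsto_poisson_of_recursion (q := fun n k => (P n).real {ω | W n ω = k})
    (fun _ _ => measureReal_nonneg) (fun _ _ => measureReal_le_one)
    (fun n K => mul_abs_one_sub_sum_eventCount_le (P n)
      (measurableSet_monoEvent (hX_meas n)) (s n) K) hlam hrec
  have hdiff : ∀ k, Tendsto (fun n =>
      (P n).real {ω | overflow r (fun i => X n i ω) = k} - (P n).real {ω | W n ω = k})
      atTop (𝓝 0) := by
    intro k
    refine squeeze_zero_norm' ?_ (hED 1 one_ne_zero)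
    filter_upwards [eventually_gt_atTop 0] with n hn
    refine (abs_measureReal_overflow_sub_le (P := P n) (X n) r k).trans ?_
    rw [sum_measureReal_monoEvent (hX_meas n) (hX_indep n) (hX_mem n) (hX_law n) (r + 1),
      Fintype.card_fin]
    refine le_trans (mul_le_mul_of_nonneg_right ?_ (tsum_nonneg fun m => ?_)) (hpow n hn 1)
    · exact_mod_cast Nat.choose_le_pow n (r + 2)
    · refine pow_nonneg ?_ _
      rw [← hX_law n ⟨0, hn⟩ m m.2]
      exact measureReal_nonneg
  refine tendstoInDistribution_nat_of_tendsto_singleton P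
    (fun n => (Measurable.of_discrete (f := fun x : Fin n → ℕ => overflow r x)).comp
      (measurable_pi_lambda _ (hX_meas n))) _ fun k => ?_
  rw [poissonMeasure_real_singleton]
  have h := (hdiff k).add (hWlim k)
  rw [zero_add] at h
  exact h.congr fun n => sub_add_cancel _ _
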